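/- **Proposition 2.12.** Let $r \ge 2$ (with $r=\infty$ and real-analytic allowed), let $\mathrm{Diff}_+^r(S^1)$ be the group, under composition, of orientation-preserving $C^r$-diffeomorphisms of the circle, let $G \subset \mathrm{Diff}_+^r(S^1)$ be a nonabelian subgroup, and let $H$ be a subgroup contained in the centralizer of $G$ in $\mathrm{Diff}_+^r(S^1)$. Then at least one of the following holds: a) ($H$ is abelian after powers) for each pair of elements $h_1, h_2 \in H$ there are nonzero integers $k_1$ and $k_2$ such that $h_1^{k_1}$ and $h_2^{k_2}$ commute; b) ($G$ fixes an interval after powers) there is a nondegenerate subinterval $J \subset S^1$ and, for each $g \in G$, a nonzero integer $k_g$ such that $g^{k_g}(x) = x$ for every $x \in J$. -/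

import Mathlib

open scoped Manifold ContDiff

/-- The group `Diff^r(S¹)`: the `C^r`-diffeomorphisms of the circle. -/
abbrev CircleDiffeo (r : WithTop ℕ∞) : Type :=
  Diffeomorph (𝓡 1) (𝓡 1) Circle Circle r

namespace CircleDiffeo

/-- The group law is composition: `(f * g) x = f (g x)`. -/
noncomputable instance instGroup (r : WithTop ℕ∞) : Group (CircleDiffeo r) where
  mul f g := Diffeomorph.trans g f
  one := Diffeomorph.refl (𝓡 1) Circle r
  inv f := Diffeomorph.symm f
  mul_assoc _ _ _ := Diffeomorph.ext fun _ => rfl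
  one_mul _ := Diffeomorph.ext fun _ => rfl
  mul_one _ := Diffeomorph.ext fun _ => rfl
  inv_mul_cancel f := Diffeomorph.ext fun x => Diffeomorph.symm_apply_apply f x

theorem mul_apply {r : WithTop ℕ∞} (f g : CircleDiffeo r) (x : Circle) :
    (f * g) x = f (g x) := rfl

theorem one_apply {r : WithTop ℕ∞} (x : Circle) : (1 : CircleDiffeo r) x = x := rfl

theorem inv_apply_apply {r : WithTop ℕ∞} (f : CircleDiffeo r) (x : Circle) :
    f⁻¹ (f x) = x := Diffeomorph.symm_apply_apply f x

/-- `f` preserves the orientation of the circle: it lifts, through the universal covering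
`t ↦ exp (i t)`, to an increasing bijection (equivalently, an increasing homeomorphism) of `ℝ`. -/
def OrientationPreserving {r : WithTop ℕ∞} (f : CircleDiffeo r) : Prop :=
  ∃ F : ℝ ≃o ℝ, ∀ t : ℝ, Circle.exp (F t) = f (Circle.exp t)

end CircleDiffeo

/-- The group `Diff₊^r(S¹)` of orientation-preserving `C^r`-diffeomorphisms of the circle. -/
def DiffPlus (r : WithTop ℕ∞) : Subgroup (CircleDiffeo r) where
  carrier := {f | f.OrientationPreserving}
  mul_mem' := by
    rintro f g ⟨F, hF⟩ ⟨G, hG⟩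
    refine ⟨G.trans F, fun t => ?_⟩
    rw [CircleDiffeo.mul_apply, ← hG, ← hF]
    rfl
  one_mem' := ⟨OrderIso.refl ℝ, fun _ => rfl⟩
  inv_mem' := by
    rintro f ⟨F, hF⟩
    refine ⟨F.symm, fun t => ?_⟩
    have h := hF (F.symm t)
    rw [OrderIso.apply_symm_apply] at h
    rw [h, CircleDiffeo.inv_apply_apply]

/-- `J` is a (nondegenerate, proper, closed) subinterval of the circle. -/
def IsCircleInterval (J : Set Circle) : Prop :=
  ∃ a b : ℝ, a < b ∧ b < a + 2 * Real.pi ∧ J = Circle.exp '' Set.Icc a b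

/-! Everything is lifted to the line, where "rational rotation number" means that some power of the
diffeomorphism has a lift with fixed points. If some `g ∈ G` has an aperiodic lift, Denjoy's theorem
(`denjoy`) makes that lift minimal modulo `2π`. A lift commuting with it has a closed invariant
fixed set, hence fixes nothing or everything; the centralizer acts freely, so by Hölder's theorem
(`OrderIso.hoelder_commute`) it is commutative, and so is `H`. By symmetry an aperiodic element of
`H` would make `G` abelian, which is excluded. So all elements of `G` and `H` may be replaced by
powers having lifts with fixed points. Let `A`, `B` be such lifts from `H` and `K` one from `G`.
Kopell's lemma (`kopell`) shows that `A` and `B` preserve each component of the complement of `Fix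
K`, and that the maps commuting with `K` and preserving this component act freely on it; Hölder's
theorem then gives `A B = B A` wherever `K` moves points (`commute_apply_of_ne`). Hence, if `A` and
`B` fail to commute, they do so throughout some interval, and on it every such `K` is the identity:
this is alternative b). -/

open Set Filter Topology

/-! ### Periodic diffeomorphisms of the line and bounded distortion. -/

/-- The group of increasing `C²`-diffeomorphisms of `ℝ` commuting with the translation by `2π`:
these are the lifts of the orientation-preserving `C²`-diffeomorphisms of the circle. -/
def PeriodicDiffeo : Subgroup (ℝ ≃o ℝ) where
  carrier := {F | (∀ t, F (t + 2 * Real.pi) = F t + 2 * Real.pi) ∧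
    ContDiff ℝ 2 F ∧ ContDiff ℝ 2 F.symm}
  mul_mem' := by
    rintro F G ⟨hF, hF1, hF2⟩ ⟨hG, hG1, hG2⟩
    exact ⟨fun t => by simp only [RelIso.mul_apply, hG, hF], hF1.comp hG1, hG2.comp hF2⟩
  one_mem' := ⟨fun _ => rfl, contDiff_id, contDiff_id⟩
  inv_mem' := by
    rintro F ⟨hF, hF1, hF2⟩
    refine ⟨fun t => F.injective ?_, hF2, hF1⟩
    rw [hF, RelIso.apply_inv_self, RelIso.apply_inv_self]

namespace PeriodicDiffeo

variable {F G : ℝ ≃o ℝ}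

theorem apply_add_int (hF : ∀ t, F (t + 2 * Real.pi) = F t + 2 * Real.pi) (t : ℝ) (m : ℤ) :
    F (t + m * (2 * Real.pi)) = F t + m * (2 * Real.pi) := by
  have key : ∀ (n : ℕ) (s : ℝ), F (s + n * (2 * Real.pi)) = F s + n * (2 * Real.pi) := by
    intro n
    induction n with
    | zero => intro s; simp
    | succ k ih =>
      intro s
      push_cast
      rw [add_mul, one_mul, ← add_assoc, hF, ih, add_assoc]
  obtain ⟨n, rfl | rfl⟩ := m.eq_nat_or_neg
  · exact_mod_cast key n t
  · have h := key n (t + (-(n : ℤ) : ℤ) * (2 * Real.pi))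
    push_cast at h ⊢
    rw [show t + -(n : ℝ) * (2 * Real.pi) + n * (2 * Real.pi) = t by ring] at h
    rw [h]
    ring

/-- The translation by `m * 2π`. -/
noncomputable def shift (m : ℤ) : ℝ ≃o ℝ := OrderIso.addRight (m * (2 * Real.pi))

theorem shift_apply (m : ℤ) (t : ℝ) : shift m t = t + m * (2 * Real.pi) := rfl

theorem differentiable (hF : F ∈ PeriodicDiffeo) : Differentiable ℝ F :=
  hF.2.1.differentiable (by norm_num)

theorem deriv_pos (hF : F ∈ PeriodicDiffeo) (t : ℝ) : 0 < deriv F t := by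
  have h0 : 0 ≤ deriv F t := F.monotone.deriv_nonneg
  have hs : DifferentiableAt ℝ F.symm (F t) := hF.2.2.differentiable (by norm_num) _
  have h1 : deriv (F.symm ∘ F) t = deriv F.symm (F t) * deriv F t :=
    deriv_comp t hs (differentiable hF t)
  have h2 : (F.symm ∘ F : ℝ → ℝ) = id := by ext x; simp
  rw [h2, deriv_id] at h1
  refine lt_of_le_of_ne h0 fun h => ?_
  rw [← h, mul_zero] at h1
  exact one_ne_zero h1

theorem deriv_periodic (hF : F ∈ PeriodicDiffeo) : Function.Periodic (deriv F) (2 * Real.pi) := by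
  intro t
  have h : (fun x => F (x + 2 * Real.pi)) = fun x => F x + 2 * Real.pi := funext hF.1
  rw [← deriv_comp_add_const, h, deriv_add_const]

/-- The logarithm of the derivative is Lipschitz. -/
theorem exists_log_deriv_lipschitz (hF : F ∈ PeriodicDiffeo) :
    ∃ K : ℝ, 0 ≤ K ∧ ∀ x y, Real.log (deriv F x) - Real.log (deriv F y) ≤ K * |x - y| := by
  have hd : ContDiff ℝ 1 (deriv F) := by
    have := (contDiff_succ_iff_deriv (n := 1) (f := F)).1 (by exact_mod_cast hF.2.1)
    exact this.2.2
  have hl : ContDiff ℝ 1 (fun x => Real.log (deriv F x)) :=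
    hd.log fun x => (deriv_pos hF x).ne'
  have hp : Function.Periodic (deriv fun x => Real.log (deriv F x)) (2 * Real.pi) := by
    intro t
    rw [← deriv_comp_add_const]
    congr 1
    ext x
    rw [deriv_periodic hF x]
  -- The `C²` hypothesis enters here: the derivative of `log F'` is continuous and periodic, hence
  -- bounded.
  have hc : Continuous (deriv fun x => Real.log (deriv F x)) := hl.continuous_deriv le_rfl
  obtain ⟨K, hK⟩ := (isCompact_Icc (a := (0 : ℝ)) (b := 0 + 2 * Real.pi)).exists_bound_of_continuousOn
    hc.continuousOn
  have hK' : ∀ x, ‖deriv (fun x => Real.log (deriv F x)) x‖ ≤ K := by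
    intro x
    obtain ⟨y, hy, hxy⟩ := hp.exists_mem_Ico₀ Real.two_pi_pos x
    rw [hxy]
    exact hK y ⟨hy.1, by linarith [hy.2]⟩
  refine ⟨K, (norm_nonneg _).trans (hK' 0), fun x y => ?_⟩
  have := Convex.norm_image_sub_le_of_norm_deriv_le (s := univ)
    (fun x _ => hl.differentiable one_ne_zero x) (fun x _ => hK' x) convex_univ
    (mem_univ y) (mem_univ x)
  exact (le_abs_self _).trans this

theorem pow_succ_apply (F : ℝ ≃o ℝ) (n : ℕ) (t : ℝ) : (F ^ (n + 1)) t = F ((F ^ n) t) := by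
  rw [pow_succ', RelIso.mul_apply]

theorem hasDerivAt_pow (hF : F ∈ PeriodicDiffeo) (n : ℕ) (t : ℝ) :
    HasDerivAt (F ^ n : ℝ ≃o ℝ) (∏ j ∈ Finset.range n, deriv F ((F ^ j) t)) t := by
  induction n with
  | zero => simpa using hasDerivAt_id t
  | succ n ih =>
    have h := ((differentiable hF ((F ^ n) t)).hasDerivAt).comp t ih
    rw [Finset.prod_range_succ, mul_comm]
    convert! h using 1
    ext s
    exact pow_succ_apply F n s

/-- Bounded distortion. -/
theorem deriv_pow_le {K : ℝ} (hF : F ∈ PeriodicDiffeo)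
    (hK : ∀ x y, Real.log (deriv F x) - Real.log (deriv F y) ≤ K * |x - y|) (n : ℕ) (x y : ℝ) :
    deriv (F ^ n : ℝ ≃o ℝ) x ≤
      Real.exp (K * ∑ j ∈ Finset.range n, |(F ^ j) x - (F ^ j) y|) *
        deriv (F ^ n : ℝ ≃o ℝ) y := by
  rw [(hasDerivAt_pow hF n x).deriv, (hasDerivAt_pow hF n y).deriv]
  induction n with
  | zero => simp
  | succ n ih =>
    rw [Finset.prod_range_succ, Finset.prod_range_succ, Finset.sum_range_succ, mul_add,
      Real.exp_add]
    have h1 : deriv F ((F ^ n) x) ≤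
        Real.exp (K * |(F ^ n) x - (F ^ n) y|) * deriv F ((F ^ n) y) := by
      have h := hK ((F ^ n) x) ((F ^ n) y)
      rw [← Real.log_le_log_iff (deriv_pos hF _) (mul_pos (Real.exp_pos _) (deriv_pos hF _)),
        Real.log_mul (Real.exp_pos _).ne' (deriv_pos hF _).ne', Real.log_exp]
      linarith
    calc _ ≤ _ := mul_le_mul ih h1 (deriv_pos hF _).le
          (mul_nonneg (Real.exp_pos _).le (Finset.prod_nonneg fun j _ => (deriv_pos hF _).le))
      _ = _ := by ring

end PeriodicDiffeo

/-! ### Hölder's theorem for archimedean preorders. -/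

section Hoelder

variable {Γ : Type*} [Group Γ] {e : Γ → ℝ}

/-- An archimedean bi-invariant total preorder, given by a real-valued function, on a group whose
associated strict order is compatible with multiplication identifies `a * b` with `b * a`. -/
theorem hoelder_not_lt (hl : ∀ a b c, e a < e b → e (c * a) < e (c * b))
    (hr : ∀ a b c, e a < e b → e (a * c) < e (b * c))
    (harch : ∀ a b, e 1 < e b → ∃ n : ℕ, e a < e (b ^ n)) (a b : Γ) :
    ¬ e (b * a) < e (a * b) := by
  intro hlt
  have hl' : ∀ a b c, e a ≤ e b → e (c * a) ≤ e (c * b) := by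
    intro a b c h
    by_contra! h'
    have := hl _ _ c⁻¹ h'
    simp only [inv_mul_cancel_left] at this
    exact this.not_ge h
  have hr' : ∀ a b c, e a ≤ e b → e (a * c) ≤ e (b * c) := by
    intro a b c h
    by_contra! h'
    have := hr _ _ c⁻¹ h'
    simp only [mul_inv_cancel_right] at this
    exact this.not_ge h
  have hpow : ∀ d, e 1 < e d → StrictMono fun m : ℤ => e (d ^ m) := by
    intro d hd
    refine strictMono_int_of_lt_succ fun m => ?_
    have := hl _ _ (d ^ m) hd
    rwa [mul_one, ← zpow_add_one] at this
  have hfloor : ∀ d, e 1 < e d → ∀ x, ∃ m : ℤ, e (d ^ m) ≤ e x ∧ e x < e (d ^ (m + 1)) := by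
    intro d hd x
    obtain ⟨N, hN⟩ := harch x d hd
    obtain ⟨M, hM⟩ := harch x⁻¹ d hd
    have hM' : e (d ^ (-(M : ℤ))) ≤ e x := by
      have h1 := hl _ _ x hM
      have h2 := hr _ _ (d ^ (-(M : ℤ))) h1
      rw [mul_inv_cancel, one_mul, mul_assoc, ← zpow_natCast, ← zpow_add, add_neg_cancel, zpow_zero,
        mul_one] at h2
      exact h2.le
    obtain ⟨m, hm, hmax⟩ := Int.exists_greatest_of_bdd (P := fun m : ℤ => e (d ^ m) ≤ e x)
      ⟨N, fun z hz => by
        by_contra! hlt'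
        have := (hpow d hd) hlt'
        simp only [zpow_natCast] at this
        linarith⟩ ⟨_, hM'⟩
    refine ⟨m, hm, ?_⟩
    by_contra! h
    have := hmax _ h
    omega
  set c := a * b * (b * a)⁻¹ with hc
  have hc1 : e 1 < e c := by
    have := hr _ _ (b * a)⁻¹ hlt
    rwa [mul_inv_cancel] at this
  -- If `c` dominates a square `d * d` with `d` positive, bracketing `a` and `b` between consecutive
  -- powers of `d` gives the contradictory bound `c < d * d`.
  by_cases hd : ∃ d, e 1 < e d ∧ e (d * d) ≤ e c
  · obtain ⟨d, hd1, hdc⟩ := hd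
    obtain ⟨m, hm1, hm2⟩ := hfloor d hd1 a
    obtain ⟨n, hn1, hn2⟩ := hfloor d hd1 b
    have h1 : e (a * b) < e (d ^ (m + 1) * d ^ (n + 1)) :=
      (hr _ _ b hm2).trans (hl _ _ _ hn2)
    have h2 : e (d ^ n * d ^ m) ≤ e (b * a) := (hr' _ _ _ hn1).trans (hl' _ _ _ hm1)
    have h3 : e ((b * a)⁻¹) ≤ e ((d ^ n * d ^ m)⁻¹) := by
      have h := hr' _ _ (b * a)⁻¹ (hl' _ _ (d ^ n * d ^ m)⁻¹ h2)
      rwa [inv_mul_cancel, one_mul, mul_assoc, mul_inv_cancel, mul_one] at h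
    have h4 : e c < e (d ^ (m + 1) * d ^ (n + 1) * (d ^ n * d ^ m)⁻¹) :=
      (hr _ _ (b * a)⁻¹ h1).trans_le (hl' _ _ _ h3)
    have h5 : d ^ (m + 1) * d ^ (n + 1) * (d ^ n * d ^ m)⁻¹ = d * d := by
      rw [← zpow_add, ← zpow_add, ← zpow_neg, ← zpow_add]
      rw [show m + 1 + (n + 1) + -(n + m) = 2 by ring]
      exact zpow_two d
    rw [h5] at h4
    linarith
  · push Not at hd
    -- Otherwise `c` is a least positive element: for `1 < d < c`, the smaller of `d` and `d⁻¹ * c`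
    -- would have square at most `c`. Every element is then equivalent to a power of `c`, and powers
    -- of `c` commute.
    have hmin : ∀ d, e 1 < e d → e c ≤ e d := by
      intro d hd1
      by_contra! hdc
      have h1 : e 1 < e (d⁻¹ * c) := by
        have := hl _ _ d⁻¹ hdc
        rwa [inv_mul_cancel] at this
      have hdc' : d * (d⁻¹ * c) = c := mul_inv_cancel_left _ _
      rcases le_total (e d) (e (d⁻¹ * c)) with h | h
      · have h2 := hl' _ _ d h
        rw [hdc'] at h2
        exact (hd d hd1).not_ge h2
      · have h2 := hr' _ _ (d⁻¹ * c) h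
        rw [hdc'] at h2
        exact (hd _ h1).not_ge h2
    have heq : ∀ x, ∃ m : ℤ, e x = e (c ^ m) := by
      intro x
      obtain ⟨m, hm1, hm2⟩ := hfloor c hc1 x
      refine ⟨m, le_antisymm ?_ hm1⟩
      have h1 := hl _ _ (c ^ m)⁻¹ hm2
      rw [zpow_add_one, inv_mul_cancel_left] at h1
      have h2 : e ((c ^ m)⁻¹ * x) ≤ e 1 := by
        by_contra! h
        exact (hmin _ h).not_gt h1
      have h3 := hl' _ _ (c ^ m) h2
      rwa [mul_inv_cancel_left, mul_one] at h3
    obtain ⟨m, hm⟩ := heq a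
    obtain ⟨n, hn⟩ := heq b
    have h1 : e (a * b) ≤ e (c ^ m * c ^ n) := (hr' _ _ _ hm.le).trans (hl' _ _ _ hn.le)
    have h2 : e (c ^ n * c ^ m) ≤ e (b * a) := (hr' _ _ _ hn.ge).trans (hl' _ _ _ hm.ge)
    rw [← zpow_add] at h1 h2
    rw [add_comm] at h2
    linarith

end Hoelder

/-! ### Orbits of increasing bijections, and Hölder's theorem for free actions. -/

/-- The fixed points of an increasing bijection form a closed set. -/
theorem OrderIso.isClosed_fixedPoints (F : ℝ ≃o ℝ) : IsClosed {t | F t = t} :=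
  isClosed_eq F.continuous continuous_id

theorem OrderIso.lt_of_lt_of_ordConnected {F : ℝ ≃o ℝ} {S : Set ℝ} (hS : S.OrdConnected)
    (hF : ∀ x ∈ S, F x ≠ x) {x y : ℝ} (hx : x ∈ S) (hy : y ∈ S) (h : F x < x) : F y < y := by
  by_contra! h'
  have hc : IsPreconnected S := hS.isPreconnected
  obtain ⟨z, hz, hz'⟩ := hc.intermediate_value₂ hx hy F.continuous.continuousOn
    continuousOn_id h.le h'
  exact hF z hz hz'

theorem OrderIso.exists_lt_pow_apply {F : ℝ ≃o ℝ} {x y : ℝ} (h : ∀ t ∈ Icc x y, t < F t) :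
    ∃ n : ℕ, y < (F ^ n) x := by
  by_contra! hle
  have hsucc : ∀ n : ℕ, (F ^ (n + 1)) x = F ((F ^ n) x) := fun n =>
    PeriodicDiffeo.pow_succ_apply F n x
  have hge : ∀ n : ℕ, x ≤ (F ^ n) x := by
    intro n
    induction n with
    | zero => exact le_rfl
    | succ n ih => rw [hsucc]; exact ih.trans (h _ ⟨ih, hle n⟩).le
  have hmono : Monotone fun n : ℕ => (F ^ n) x :=
    monotone_nat_of_le_succ fun n => by rw [hsucc]; exact (h _ ⟨hge n, hle n⟩).le
  have hlim := tendsto_atTop_ciSup hmono ⟨y, by rintro _ ⟨n, rfl⟩; exact hle n⟩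
  set l := ⨆ n : ℕ, (F ^ n) x
  have h1 : Tendsto (fun n : ℕ => (F ^ (n + 1)) x) atTop (𝓝 l) :=
    (tendsto_add_atTop_iff_nat 1).2 hlim
  have h2 : Tendsto (fun n : ℕ => (F ^ (n + 1)) x) atTop (𝓝 (F l)) := by
    simp only [hsucc]
    exact (F.continuous.tendsto l).comp hlim
  exact (h l ⟨ge_of_tendsto' hlim hge, le_of_tendsto' hlim hle⟩).ne (tendsto_nhds_unique h1 h2)

theorem OrderIso.tendsto_pow_of_lt {F : ℝ ≃o ℝ} {p q u : ℝ} (hp : F p = p)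
    (h : ∀ x ∈ Ioo p q, F x < x) (hu : u ∈ Ioo p q) :
    (∀ n : ℕ, (F ^ n) u ∈ Ioo p q) ∧ (Antitone fun n : ℕ => (F ^ n) u) ∧
      Tendsto (fun n : ℕ => (F ^ n) u) atTop (𝓝 p) := by
  have hsucc : ∀ n : ℕ, (F ^ (n + 1)) u = F ((F ^ n) u) := fun n =>
    PeriodicDiffeo.pow_succ_apply F n u
  have hmem : ∀ n : ℕ, (F ^ n) u ∈ Ioo p q := by
    intro n
    induction n with
    | zero => exact hu
    | succ n ih =>
      rw [hsucc]
      refine ⟨?_, (h _ ih).trans ih.2⟩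
      conv_lhs => rw [← hp]
      exact F.strictMono ih.1
  have hanti : Antitone fun n : ℕ => (F ^ n) u :=
    antitone_nat_of_succ_le fun n => by rw [hsucc]; exact (h _ (hmem n)).le
  refine ⟨hmem, hanti, ?_⟩
  have hlim := tendsto_atTop_ciInf hanti ⟨p, by rintro _ ⟨n, rfl⟩; exact (hmem n).1.le⟩
  set l := ⨅ n : ℕ, (F ^ n) u
  have h1 : Tendsto (fun n : ℕ => (F ^ (n + 1)) u) atTop (𝓝 l) :=
    (tendsto_add_atTop_iff_nat 1).2 hlim
  have h2 : Tendsto (fun n : ℕ => (F ^ (n + 1)) u) atTop (𝓝 (F l)) := by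
    simp only [hsucc]
    exact (F.continuous.tendsto l).comp hlim
  have hl : F l = l := tendsto_nhds_unique h2 h1
  have hpl : p ≤ l := ge_of_tendsto' hlim fun n => (hmem n).1.le
  have hlu : l ≤ u := le_of_tendsto' hlim fun n => hanti (Nat.zero_le n)
  rcases hpl.eq_or_lt with hpl | hpl
  · rwa [hpl]
  · exact absurd hl (h l ⟨hpl, hlu.trans_lt hu.2⟩).ne

/-- **Hölder's theorem**: a group of increasing homeomorphisms acting freely on an interval
(modulo elements acting trivially) acts through a commutative group. -/
theorem OrderIso.hoelder_commute {Γ : Subgroup (ℝ ≃o ℝ)} {S : Set ℝ} (hS : S.OrdConnected)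
    (hΓ : ∀ γ ∈ Γ, ∀ x ∈ S, γ x ∈ S)
    (hfree : ∀ γ ∈ Γ, ∀ x ∈ S, γ x = x → ∀ y ∈ S, γ y = y)
    {a b : ℝ ≃o ℝ} (ha : a ∈ Γ) (hb : b ∈ Γ) {x : ℝ} (hx : x ∈ S) : a (b x) = b (a x) := by
  have hsign : ∀ γ ∈ Γ, ∀ x ∈ S, ∀ y ∈ S, γ x < x → γ y < y := by
    intro γ hγ x hx y hy h
    exact lt_of_lt_of_ordConnected hS
      (fun z hz hz' => h.ne (hfree γ hγ z hz hz' x hx)) hx hy h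
  -- Elements are ordered by the image of one point. Left invariance is monotonicity; right
  -- invariance holds because, by freeness, the sign of `γ y - y` is constant on `S`.
  let e : Γ → ℝ := fun γ => (γ : ℝ ≃o ℝ) x
  have hl : ∀ a b c, e a < e b → e (c * a) < e (c * b) := fun a b c h =>
    (c : ℝ ≃o ℝ).strictMono h
  have hr : ∀ a b c, e a < e b → e (a * c) < e (b * c) := by
    intro a b c h
    have h1 : ((b⁻¹ * a : Γ) : ℝ ≃o ℝ) x < x := by
      have := (b⁻¹ : ℝ ≃o ℝ).strictMono h
      simp only [e, RelIso.inv_apply_self] at this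
      exact this
    have h2 := (b : ℝ ≃o ℝ).strictMono
      (hsign _ (b⁻¹ * a).2 x hx _ (hΓ c c.2 x hx) h1)
    have h3 : (b : ℝ ≃o ℝ) (((b⁻¹ * a : Γ) : ℝ ≃o ℝ) ((c : ℝ ≃o ℝ) x)) = (a : ℝ ≃o ℝ) ((c : ℝ ≃o ℝ) x) := by
      rw [← RelIso.mul_apply, ← Subgroup.coe_mul, mul_inv_cancel_left]
    rw [h3] at h2
    exact h2
  have harch : ∀ a b, e 1 < e b → ∃ n : ℕ, e a < e (b ^ n) := by
    intro a b h
    have h1 : ((b⁻¹ : Γ) : ℝ ≃o ℝ) x < x := by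
      have := (b⁻¹ : ℝ ≃o ℝ).strictMono h
      simp only [e, RelIso.inv_apply_self] at this
      exact this
    refine exists_lt_pow_apply (F := b) fun t ht => ?_
    have h2 := hsign _ (b⁻¹).2 x hx t (hS.out hx (hΓ a a.2 x hx) ht) h1
    have h3 := (b : ℝ ≃o ℝ).strictMono h2
    rwa [Subgroup.coe_inv, RelIso.apply_inv_self] at h3
  have h1 := hoelder_not_lt hl hr harch ⟨a, ha⟩ ⟨b, hb⟩
  have h2 := hoelder_not_lt hl hr harch ⟨b, hb⟩ ⟨a, ha⟩
  exact le_antisymm (not_lt.1 h1) (not_lt.1 h2)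

/-! ### Kopell's lemma. -/

namespace PeriodicDiffeo

variable {F G : ℝ ≃o ℝ}

theorem commute_apply (h : Commute F G) (t : ℝ) : F (G t) = G (F t) :=
  DFunLike.congr_fun h.eq t

theorem pow_apply_eq_self {x : ℝ} (h : F x = x) (n : ℕ) : (F ^ n) x = x := by
  induction n with
  | zero => rfl
  | succ n ih => rw [pow_succ_apply, ih, h]

theorem inv_apply_eq_self {x : ℝ} (h : F x = x) : F⁻¹ x = x := by
  conv_lhs => rw [← h]
  exact RelIso.inv_apply_self F x

theorem continuous_deriv (hF : F ∈ PeriodicDiffeo) : Continuous (deriv F) :=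
  hF.2.1.continuous_deriv (by norm_num)

/-- A diffeomorphism fixing a sequence that converges to `p` is tangent to the identity at `p`. -/
theorem deriv_eq_one_of_tendsto (hG : G ∈ PeriodicDiffeo) {p : ℝ} {s : ℕ → ℝ}
    (hs : Tendsto s atTop (𝓝 p)) (hp : ∀ n, s n ≠ p) (hfix : ∀ n, G (s n) = s n) :
    G p = p ∧ deriv G p = 1 := by
  have hGp : G p = p := by
    have h1 : Tendsto (fun n => G (s n)) atTop (𝓝 (G p)) := (G.continuous.tendsto p).comp hs
    simp only [hfix] at h1
    exact tendsto_nhds_unique h1 hs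
  refine ⟨hGp, ?_⟩
  have h1 := (hasDerivAt_iff_tendsto_slope.1 (differentiable hG p).hasDerivAt).comp
    (tendsto_nhdsWithin_iff.2 ⟨hs, Eventually.of_forall hp⟩)
  have h2 : (slope G p ∘ s) = fun _ => 1 := by
    ext n
    simp only [Function.comp, slope_def_field, hfix, hGp]
    exact div_self (sub_ne_zero.2 (hp n))
  rw [h2] at h1
  exact tendsto_nhds_unique h1 tendsto_const_nhds

/-- Differentiating `F ^ n ∘ G = G ∘ F ^ n` expresses `G'(x)` as `G'(Fⁿ x)` times a distortion ratio
of `F ^ n`. The ratio is controlled because the images of `[F w, w]` tile part of `[p, w]`, and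
`G'(Fⁿ x) → G'(p) = 1`. The bound does not depend on `G`, so it applies to all powers of `G` at
once. -/
theorem deriv_le_of_commute {K : ℝ} (hK0 : 0 ≤ K) (hF : F ∈ PeriodicDiffeo)
    (hG : G ∈ PeriodicDiffeo) (hFG : Commute F G)
    (hK : ∀ x y, Real.log (deriv F x) - Real.log (deriv F y) ≤ K * |x - y|)
    {p q w : ℝ} (hp : F p = p) (h : ∀ x ∈ Ioo p q, F x < x) (hw : w ∈ Ioo p q) (hGw : G w = w)
    {x : ℝ} (hx : x ∈ Icc (F w) w) : deriv G x ≤ Real.exp (K * (w - p)) := by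
  obtain ⟨hmem, -, hlim⟩ := OrderIso.tendsto_pow_of_lt hp h hw
  have hcomm : ∀ (n : ℕ) t, (F ^ n) (G t) = G ((F ^ n) t) := fun n t =>
    commute_apply (hFG.pow_left n) t
  have hGp := deriv_eq_one_of_tendsto hG hlim (fun n => (hmem n).1.ne')
    (fun n => by rw [← hcomm, hGw])
  have hFw : F w ∈ Ioo p q := by simpa using hmem 1
  have hGx : G x ∈ Icc (F w) w := by
    refine ⟨?_, ?_⟩
    · have := G.monotone hx.1
      rwa [← commute_apply hFG, hGw] at this
    · have := G.monotone hx.2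
      rwa [hGw] at this
  have hxm : x ∈ Ioo p q := ⟨hFw.1.trans_le hx.1, hx.2.trans_lt hw.2⟩
  have hbound : ∀ n : ℕ, deriv G x ≤ Real.exp (K * (w - p)) * deriv G ((F ^ n) x) := by
    intro n
    have hFn : F ^ n ∈ PeriodicDiffeo := Subgroup.pow_mem _ hF n
    have h1 : deriv G ((F ^ n) x) * deriv (F ^ n : ℝ ≃o ℝ) x =
        deriv (F ^ n : ℝ ≃o ℝ) (G x) * deriv G x := by
      rw [← deriv_comp x (differentiable hG _) (differentiable hFn _),
        ← deriv_comp x (differentiable hFn _) (differentiable hG _)]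
      congr 1
      ext t
      exact (hcomm n t).symm
    have h2 := deriv_pow_le hF hK n x (G x)
    have hsum : ∑ j ∈ Finset.range n, |(F ^ j) x - (F ^ j) (G x)| ≤ w - p := by
      calc _ ≤ ∑ j ∈ Finset.range n, ((F ^ j) w - (F ^ (j + 1)) w) := by
            refine Finset.sum_le_sum fun j _ => ?_
            have hF' : (F ^ (j + 1)) w = (F ^ j) (F w) := by rw [pow_succ, RelIso.mul_apply]
            rw [hF', abs_le]
            have m1 := (F ^ j).monotone hx.1
            have m2 := (F ^ j).monotone hx.2
            have m3 := (F ^ j).monotone hGx.1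
            have m4 := (F ^ j).monotone hGx.2
            constructor <;> linarith
        _ = w - (F ^ n) w := by
            rw [Finset.sum_range_sub' (fun j => (F ^ j) w)]
            simp
        _ ≤ w - p := by linarith [(hmem n).1]
    have hexp : Real.exp (K * ∑ j ∈ Finset.range n, |(F ^ j) x - (F ^ j) (G x)|) ≤
        Real.exp (K * (w - p)) := Real.exp_le_exp.2 (mul_le_mul_of_nonneg_left hsum hK0)
    have hpos := deriv_pos hFn (G x)
    have h3 := h2.trans (mul_le_mul_of_nonneg_right hexp hpos.le)
    have h4 := mul_le_mul_of_nonneg_left h3 (deriv_pos hG ((F ^ n) x)).le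
    rw [h1] at h4
    refine le_of_mul_le_mul_left (h4.trans_eq ?_) hpos
    ring
  have hlimx := (OrderIso.tendsto_pow_of_lt hp h hxm).2.2
  have hlim' : Tendsto (fun n : ℕ => Real.exp (K * (w - p)) * deriv G ((F ^ n) x)) atTop
      (𝓝 (Real.exp (K * (w - p)) * 1)) := by
    rw [← hGp.2]
    exact (((continuous_deriv hG).tendsto p).comp hlimx).const_mul _
  rw [mul_one] at hlim'
  exact ge_of_tendsto' hlim' hbound

/-- If `x < G x`, the backward orbit of `x` decreases to a fixed point `l`. Then `G ^ m` stretches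
the vanishing interval `[l, G⁻ᵐ x]` onto the fixed interval `[l, x]`, against the uniform bound on
derivatives. -/
theorem apply_le_of_deriv_pow_le (hG : G ∈ PeriodicDiffeo) {a b M : ℝ} (ha : G a = a)
    (hM : ∀ m : ℕ, ∀ x ∈ Icc a b, deriv (G ^ m : ℝ ≃o ℝ) x ≤ M) {x : ℝ} (hx : x ∈ Icc a b) :
    G x ≤ x := by
  by_contra! hlt
  have hinv : ∀ t, t < G t → G⁻¹ t < t := by
    intro t ht
    have := G⁻¹.strictMono ht
    rwa [RelIso.inv_apply_self] at this
  have hanti : Antitone fun n : ℕ => (G⁻¹ ^ n) x := by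
    refine antitone_nat_of_succ_le fun n => ?_
    rw [pow_succ, RelIso.mul_apply]
    exact (G⁻¹ ^ n).monotone (hinv x hlt).le
  have hge : ∀ n : ℕ, a ≤ (G⁻¹ ^ n) x := by
    intro n
    have := (G⁻¹ ^ n).monotone hx.1
    rwa [pow_apply_eq_self (inv_apply_eq_self ha)] at this
  have hlim := tendsto_atTop_ciInf hanti ⟨a, by rintro _ ⟨n, rfl⟩; exact hge n⟩
  set l := ⨅ n : ℕ, (G⁻¹ ^ n) x
  have hal : a ≤ l := ge_of_tendsto' hlim hge
  have hlx : l ≤ G⁻¹ x := by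
    refine le_of_tendsto hlim ((eventually_ge_atTop 1).mono fun n hn => ?_)
    simpa using hanti hn
  have hl : G l = l := by
    have h1 : Tendsto (fun n : ℕ => (G⁻¹ ^ (n + 1)) x) atTop (𝓝 l) :=
      (tendsto_add_atTop_iff_nat 1).2 hlim
    have h2 := (G.continuous.tendsto l).comp h1
    have h3 : (G ∘ fun n : ℕ => (G⁻¹ ^ (n + 1)) x) = fun n : ℕ => (G⁻¹ ^ n) x := by
      ext n
      rw [Function.comp_apply, pow_succ_apply, RelIso.apply_inv_self]
    rw [h3] at h2
    exact tendsto_nhds_unique h2 hlim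
  have hxl : ∀ m : ℕ, x - l ≤ M * ((G⁻¹ ^ m) x - l) := by
    intro m
    have hGm : G ^ m ∈ PeriodicDiffeo := Subgroup.pow_mem _ hG m
    have hlm : l ≤ (G⁻¹ ^ m) x := by
      have := (G⁻¹ ^ m).monotone (hlx.trans (hinv x hlt).le)
      rwa [pow_apply_eq_self (inv_apply_eq_self hl)] at this
    have h1 := Convex.image_sub_le_mul_sub_of_deriv_le (convex_Icc a b)
      (differentiable hGm).continuous.continuousOn (differentiable hGm).differentiableOn
      (fun y hy => hM m y (interior_subset hy)) l
      ⟨hal, (hlx.trans (hinv x hlt).le).trans hx.2⟩ ((G⁻¹ ^ m) x)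
      ⟨hge m, (hanti (Nat.zero_le m)).trans hx.2⟩ hlm
    rwa [pow_apply_eq_self hl, inv_pow, RelIso.apply_inv_self, ← inv_pow] at h1
  have hlim2 : Tendsto (fun m : ℕ => M * ((G⁻¹ ^ m) x - l)) atTop (𝓝 (M * (l - l))) :=
    (hlim.sub_const l).const_mul M
  have := ge_of_tendsto' hlim2 hxl
  rw [sub_self, mul_zero] at this
  linarith [hinv x hlt]

theorem kopell_of_lt (hF : F ∈ PeriodicDiffeo) (hG : G ∈ PeriodicDiffeo) (hFG : Commute F G)
    {p q u : ℝ} (hp : F p = p) (hq : F q = q) (h : ∀ x ∈ Ioo p q, F x < x) (hu : u ∈ Ioo p q)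
    (hGu : G u = u) {x : ℝ} (hx : x ∈ Ioo p q) : G x = x := by
  obtain ⟨K, hK0, hK⟩ := exists_log_deriv_lipschitz hF
  -- On a fundamental domain of `F` the previous lemma applies to both `G` and `G⁻¹`.
  have hfund : ∀ w ∈ Ioo p q, G w = w → ∀ y ∈ Icc (F w) w, G y = y := by
    intro w hw hGw y hy
    have hGFw : G (F w) = F w := by rw [← commute_apply hFG, hGw]
    have h1 := apply_le_of_deriv_pow_le hG hGFw (b := w) (M := Real.exp (K * (w - p)))
      (fun m x hx => deriv_le_of_commute hK0 hF (Subgroup.pow_mem _ hG m) (hFG.pow_right m) hK hp h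
        hw (pow_apply_eq_self hGw m) hx) hy
    have h2 := apply_le_of_deriv_pow_le (Subgroup.inv_mem _ hG) (inv_apply_eq_self hGFw) (b := w)
      (M := Real.exp (K * (w - p)))
      (fun m x hx => deriv_le_of_commute hK0 hF
        (Subgroup.pow_mem _ (Subgroup.inv_mem _ hG) m) (hFG.inv_right.pow_right m) hK hp h
        hw (pow_apply_eq_self (inv_apply_eq_self hGw) m) hx) hy
    have h3 := G.monotone h2
    rw [RelIso.apply_inv_self] at h3
    exact le_antisymm h1 h3
  have hinv : ∀ t ∈ Ioo p q, t < F⁻¹ t ∧ F⁻¹ t ∈ Ioo p q := by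
    intro t ht
    have h1 := F⁻¹.strictMono ht.1
    have h2 := F⁻¹.strictMono ht.2
    rw [inv_apply_eq_self hp] at h1
    rw [inv_apply_eq_self hq] at h2
    have h3 := h _ ⟨h1, h2⟩
    rw [RelIso.apply_inv_self] at h3
    exact ⟨h3, h1, h2⟩
  -- The fixed point `u` is moved beyond `x` by `F⁻¹`; the first iterate of `F` bringing it back to
  -- or below `x` selects the fundamental domain containing `x`.
  obtain ⟨k, hk⟩ := OrderIso.exists_lt_pow_apply (F := F⁻¹) (x := u) (y := x)
    fun t ht => (hinv t ⟨hu.1.trans_le ht.1, ht.2.trans_lt hx.2⟩).1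
  have hu' : (F⁻¹ ^ k) u ∈ Ioo p q := by
    clear hk
    induction k with
    | zero => exact hu
    | succ k ih => rw [pow_succ_apply]; exact (hinv _ ih).2
  set u' := (F⁻¹ ^ k) u
  have hGu' : G u' = u' := by
    rw [← commute_apply (hFG.inv_left.pow_left k), hGu]
  obtain ⟨hmem, -, hlim⟩ := OrderIso.tendsto_pow_of_lt hp h hu'
  have hex : ∃ n : ℕ, (F ^ n) u' ≤ x := ((hlim.eventually_lt_const hx.1).exists).imp fun n => le_of_lt
  classical
  obtain ⟨n, hn, hmin⟩ : ∃ n, (F ^ n) u' ≤ x ∧ ∀ m < n, ¬ (F ^ m) u' ≤ x :=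
    ⟨Nat.find hex, Nat.find_spec hex, fun m hm => Nat.find_min hex hm⟩
  cases n with
  | zero => exact absurd hn (not_le.2 hk)
  | succ n =>
    refine hfund ((F ^ n) u') (hmem n) ?_ x ⟨?_, (not_le.1 (hmin n n.lt_succ_self)).le⟩
    · rw [← commute_apply (hFG.pow_left n), hGu']
    · rwa [pow_succ_apply] at hn

/-- **Kopell's lemma**: if `F` and `G` commute, `F` preserves an interval and has no fixed point in
its interior, then `G` is the identity on the interval as soon as it has a fixed point in the
interior. -/
theorem kopell (hF : F ∈ PeriodicDiffeo) (hG : G ∈ PeriodicDiffeo) (hFG : Commute F G)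
    {p q u : ℝ} (hp : F p = p) (hq : F q = q) (h : ∀ x ∈ Ioo p q, F x ≠ x) (hu : u ∈ Ioo p q)
    (hGu : G u = u) {x : ℝ} (hx : x ∈ Ioo p q) : G x = x := by
  rcases (h u hu).lt_or_gt with hlt | hgt
  · exact kopell_of_lt hF hG hFG hp hq
      (fun y hy => OrderIso.lt_of_lt_of_ordConnected ordConnected_Ioo h hu hy hlt) hu hGu hx
  · have h' : ∀ y ∈ Ioo p q, F⁻¹ y ≠ y := by
      intro y hy hy'
      refine h y hy ?_
      conv_lhs => rw [← hy']
      exact RelIso.apply_inv_self F y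
    have hlt : F⁻¹ u < u := by
      have := F⁻¹.strictMono hgt
      rwa [RelIso.inv_apply_self] at this
    exact kopell_of_lt (Subgroup.inv_mem _ hF) hG hFG.inv_left (inv_apply_eq_self hp)
      (inv_apply_eq_self hq)
      (fun y hy => OrderIso.lt_of_lt_of_ordConnected ordConnected_Ioo h' hu hy hlt) hu hGu hx

/-! ### Commuting maps and the gaps of fixed point sets. -/

/-- The gaps of a closed periodic set. -/
theorem exists_gap {A : Set ℝ} (hA : IsClosed A) (hne : A.Nonempty)
    (hper : ∀ t ∈ A, ∀ m : ℤ, t + m * (2 * Real.pi) ∈ A) {t : ℝ} (ht : t ∉ A) :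
    ∃ u v, u < t ∧ t < v ∧ u ∈ A ∧ v ∈ A ∧ ∀ x ∈ Ioo u v, x ∉ A := by
  obtain ⟨s, hs⟩ := hne
  have hlow : (A ∩ Iic t).Nonempty := by
    obtain ⟨m, hm⟩ := exists_int_gt ((s - t) / (2 * Real.pi))
    refine ⟨_, hper s hs (-m), ?_⟩
    rw [div_lt_iff₀ Real.two_pi_pos] at hm
    rw [mem_Iic]
    push_cast
    linarith
  have hhigh : (A ∩ Ici t).Nonempty := by
    obtain ⟨m, hm⟩ := exists_int_gt ((t - s) / (2 * Real.pi))
    refine ⟨_, hper s hs m, ?_⟩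
    rw [div_lt_iff₀ Real.two_pi_pos] at hm
    rw [mem_Ici]
    linarith
  have bl : BddAbove (A ∩ Iic t) := ⟨t, fun x hx => hx.2⟩
  have bh : BddBelow (A ∩ Ici t) := ⟨t, fun x hx => hx.2⟩
  have hu := (hA.inter isClosed_Iic).csSup_mem hlow bl
  have hv := (hA.inter isClosed_Ici).csInf_mem hhigh bh
  refine ⟨sSup (A ∩ Iic t), sInf (A ∩ Ici t), lt_of_le_of_ne hu.2 ?_, lt_of_le_of_ne hv.2 ?_,
    hu.1, hv.1, ?_⟩
  · rintro h
    exact ht (h ▸ hu.1)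
  · rintro h
    exact ht (h ▸ hv.1)
  · intro x hx hxA
    rcases le_total x t with h | h
    · exact hx.1.not_ge (le_csSup bl ⟨hxA, h⟩)
    · exact hx.2.not_ge (csInf_le bh ⟨hxA, h⟩)

theorem fixed_periodic (hF : F ∈ PeriodicDiffeo) :
    ∀ t ∈ {t | F t = t}, ∀ m : ℤ, t + m * (2 * Real.pi) ∈ {t | F t = t} := by
  intro t ht m
  change F _ = _
  rw [apply_add_int hF.1, show F t = t from ht]

/-- If `F` and `G` commute and each has fixed points, then `F` preserves the components of the
complement of the fixed point set of `G`. -/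
theorem fix_endpoint (hF : F ∈ PeriodicDiffeo) (hG : G ∈ PeriodicDiffeo) (hFG : Commute F G)
    (hFne : ∃ t, F t = t) {u : ℝ} (hGu : G u = u)
    (hu : (∃ v, u < v ∧ ∀ x ∈ Ioo u v, G x ≠ x) ∨ (∃ v, v < u ∧ ∀ x ∈ Ioo v u, G x ≠ x)) :
    F u = u := by
  by_contra hFu
  obtain ⟨p, q, hpu, huq, hp, hq, hpq⟩ := exists_gap F.isClosed_fixedPoints hFne
    (fixed_periodic hF) (t := u) hFu
  -- If `F` moves `u`, Kopell's lemma on the gap of `Fix F` around `u` makes `G` the identity near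
  -- `u`, which cannot then bound a gap of `Fix G`.
  have hid : ∀ x ∈ Ioo p q, G x = x := fun x hx => kopell hF hG hFG hp hq hpq ⟨hpu, huq⟩ hGu hx
  rcases hu with ⟨v, huv, hv⟩ | ⟨v, hvu, hv⟩
  · obtain ⟨x, hx1, hx2⟩ := exists_between (lt_min huv huq)
    exact hv x ⟨hx1, hx2.trans_le (min_le_left _ _)⟩
      (hid x ⟨hpu.trans hx1, hx2.trans_le (min_le_right _ _)⟩)
  · obtain ⟨x, hx1, hx2⟩ := exists_between (max_lt hvu hpu)
    exact hv x ⟨(le_max_left _ _).trans_lt hx1, hx2⟩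
      (hid x ⟨(le_max_right _ _).trans_lt hx1, hx2.trans huq⟩)

/-- If `A` and `B` commute with `G`, all with fixed points, then `A` and `B` commute off the fixed
point set of `G`. -/
theorem commute_apply_of_ne {A B : ℝ ≃o ℝ} (hA : A ∈ PeriodicDiffeo) (hB : B ∈ PeriodicDiffeo)
    (hG : G ∈ PeriodicDiffeo) (hAG : Commute A G) (hBG : Commute B G) (hA0 : ∃ t, A t = t)
    (hB0 : ∃ t, B t = t) (hG0 : ∃ t, G t = t) {t : ℝ} (ht : G t ≠ t) : A (B t) = B (A t) := by
  obtain ⟨u, v, hut, htv, hu, hv, huv⟩ := exists_gap G.isClosed_fixedPoints hG0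
    (fixed_periodic hG) (t := t) ht
  -- The centralizer of `G` fixing both ends of the gap: Kopell's lemma, now with `G` as the map
  -- without fixed points, gives the freeness that Hölder's theorem needs.
  let Γ : Subgroup (ℝ ≃o ℝ) :=
    { carrier := {γ | γ ∈ PeriodicDiffeo ∧ Commute G γ ∧ γ u = u ∧ γ v = v}
      mul_mem' := by
        rintro γ δ ⟨h1, h2, h3, h4⟩ ⟨h5, h6, h7, h8⟩
        exact ⟨mul_mem h1 h5, h2.mul_right h6, by rw [RelIso.mul_apply, h7, h3],
          by rw [RelIso.mul_apply, h8, h4]⟩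
      one_mem' := ⟨one_mem _, Commute.one_right _, rfl, rfl⟩
      inv_mem' := by
        rintro γ ⟨h1, h2, h3, h4⟩
        exact ⟨inv_mem h1, h2.inv_right, inv_apply_eq_self h3, inv_apply_eq_self h4⟩ }
  have huv' : u < v := hut.trans htv
  have hmem : ∀ C : ℝ ≃o ℝ, C ∈ PeriodicDiffeo → Commute C G → (∃ t, C t = t) → C ∈ Γ :=
    fun C hC hCG hC0 => ⟨hC, hCG.symm, fix_endpoint hC hG hCG hC0 hu (Or.inl ⟨v, huv', huv⟩),
      fix_endpoint hC hG hCG hC0 hv (Or.inr ⟨u, huv', huv⟩)⟩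
  refine OrderIso.hoelder_commute (Γ := Γ) (S := Ioo u v) ordConnected_Ioo ?_ ?_ (hmem A hA hAG hA0)
    (hmem B hB hBG hB0) ⟨hut, htv⟩
  · rintro γ ⟨-, -, h3, h4⟩ x hx
    refine ⟨?_, ?_⟩
    · rw [← h3]; exact γ.strictMono hx.1
    · rw [← h4]; exact γ.strictMono hx.2
  · rintro γ ⟨h1, h2, -, -⟩ x hx hγx y hy
    exact kopell hG h1 h2 hu hv huv hx hγx hy

/-! ### Denjoy's theorem and centralizers of aperiodic maps. -/

/-- Intervals shorter than `2π` that are pairwise disjoint modulo `2π` have bounded total length. -/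
theorem sum_length_le {α β : ℕ → ℝ} (hαβ : ∀ j, α j ≤ β j) (hlen : ∀ j, β j ≤ α j + 2 * Real.pi)
    (hdisj : ∀ i j, i ≠ j → ∀ m : ℤ, Disjoint
      (Ioo (α i + m * (2 * Real.pi)) (β i + m * (2 * Real.pi))) (Ioo (α j) (β j))) (n : ℕ) :
    ∑ j ∈ Finset.range n, (β j - α j) ≤ 4 * Real.pi := by
  -- Once the left ends are translated into `[0, 2π)`, all the intervals lie in `[0, 4π]`.
  have hm : ∀ j, ∃ m : ℤ, α j + m * (2 * Real.pi) ∈ Ico 0 (2 * Real.pi) := by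
    intro j
    obtain ⟨m, hm, -⟩ := existsUnique_add_zsmul_mem_Ico Real.two_pi_pos (α j) 0
    refine ⟨m, ?_⟩
    simpa using hm
  choose m hm using hm
  let I : ℕ → Set ℝ := fun j =>
    Ioo (α j + m j * (2 * Real.pi)) (β j + m j * (2 * Real.pi))
  have hI : Set.PairwiseDisjoint (Finset.range n : Set ℕ) I := by
    intro i _ j _ hij
    refine Set.disjoint_left.2 fun x hxi hxj => ?_
    have hd := Set.disjoint_left.1 (hdisj i j hij (m i - m j))
    refine @hd (x - m j * (2 * Real.pi)) ?_ ?_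
    · obtain ⟨h1, h2⟩ := hxi
      push_cast
      constructor <;> linarith
    · obtain ⟨h1, h2⟩ := hxj
      constructor <;> linarith
  have h1 := MeasureTheory.measure_biUnion_finset (μ := MeasureTheory.volume) hI
    (fun j _ => measurableSet_Ioo)
  have h2 : (⋃ j ∈ Finset.range n, I j) ⊆ Icc 0 (4 * Real.pi) := by
    refine iUnion₂_subset fun j _ x hx => ?_
    have := (hm j).1
    have := (hm j).2
    have := hlen j
    obtain ⟨h3, h4⟩ := hx
    constructor <;> linarith
  have h3 := MeasureTheory.measure_mono (μ := MeasureTheory.volume) h2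
  rw [h1, Real.volume_Icc, sub_zero] at h3
  simp only [I, Real.volume_Ioo, add_sub_add_right_eq_sub] at h3
  rw [← ENNReal.ofReal_sum_of_nonneg fun j _ => sub_nonneg.2 (hαβ j)] at h3
  exact (ENNReal.ofReal_le_ofReal_iff (by positivity)).1 h3

/-- Closed nonempty subsets of `ℝ` invariant under `F` and under the translation by `2π`. -/
structure IsInvariantClosed (F : ℝ ≃o ℝ) (A : Set ℝ) : Prop where
  isClosed : IsClosed A
  nonempty : A.Nonempty
  add_mem : ∀ t ∈ A, ∀ m : ℤ, t + m * (2 * Real.pi) ∈ A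
  map_mem : ∀ t ∈ A, F t ∈ A

theorem IsInvariantClosed.exists_minimal {A : Set ℝ} (hA : IsInvariantClosed F A) :
    ∃ M ⊆ A, Minimal (· ∈ {B | IsInvariantClosed F B}) M := by
  refine zorn_superset_nonempty {B | IsInvariantClosed F B} ?_ A hA
  intro c hc hchain hcne
  refine ⟨⋂₀ c, ⟨isClosed_sInter fun s hs => (hc hs).isClosed, ?_, ?_, ?_⟩,
    fun s hs => sInter_subset_of_mem hs⟩
  · have : Nonempty c := hcne.to_subtype
    -- Periodicity lets every member of the chain meet `[0, 2π]`, which supplies the compactness.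
    have hne := IsCompact.nonempty_iInter_of_directed_nonempty_isCompact_isClosed
      (fun s : c => (s : Set ℝ) ∩ Icc 0 (2 * Real.pi)) ?_ ?_ ?_ ?_
    · obtain ⟨x, hx⟩ := hne
      exact ⟨x, fun s hs => (mem_iInter.1 hx ⟨s, hs⟩).1⟩
    · intro s t
      rcases hchain.total s.2 t.2 with h | h
      · exact ⟨s, Subset.rfl, inter_subset_inter_left _ h⟩
      · exact ⟨t, inter_subset_inter_left _ h, Subset.rfl⟩
    · intro s
      obtain ⟨x, hx⟩ := (hc s.2).nonempty
      obtain ⟨m, hm, -⟩ := existsUnique_add_zsmul_mem_Ico Real.two_pi_pos x 0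
      refine ⟨_, (hc s.2).add_mem x hx m, ?_⟩
      simp only [zsmul_eq_mul, zero_add] at hm
      exact Ico_subset_Icc_self hm
    · intro s
      exact isCompact_Icc.inter_left (hc s.2).isClosed
    · intro s
      exact (hc s.2).isClosed.inter isClosed_Icc
  · exact fun t ht m s hs => (hc hs).add_mem t (ht s hs) m
  · exact fun t ht s hs => (hc hs).map_mem t (ht s hs)

/-- `F` has no periodic points modulo `2π`. -/
def Aperiodic (F : ℝ ≃o ℝ) : Prop :=
  ∀ n : ℕ, n ≠ 0 → ∀ (m : ℤ) (t : ℝ), (F ^ n) t ≠ t + m * (2 * Real.pi)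

/-- The set `F '' M` is again closed and invariant, so minimality forces `F '' M = M`. Consequently
iterates of a gap of `M` stay disjoint from `M`. -/
theorem IsInvariantClosed.mem_of_map_mem {M : Set ℝ} (hF : F ∈ PeriodicDiffeo)
    (hM : Minimal (· ∈ {B | IsInvariantClosed F B}) M) {t : ℝ} (ht : F t ∈ M) : t ∈ M := by
  have hMi : IsInvariantClosed F M := hM.1
  have himg : IsInvariantClosed F (F '' M) := by
    refine ⟨F.toHomeomorph.isClosedMap _ hMi.isClosed, hMi.nonempty.image _, ?_, ?_⟩
    · rintro _ ⟨s, hs, rfl⟩ m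
      exact ⟨_, hMi.add_mem s hs m, apply_add_int hF.1 s m⟩
    · rintro _ ⟨s, hs, rfl⟩
      exact ⟨_, hMi.map_mem s hs, rfl⟩
  have hsub : F '' M ⊆ M := by
    rintro _ ⟨s, hs, rfl⟩
    exact hMi.map_mem s hs
  obtain ⟨s, hs, hst⟩ := hM.2 himg hsub ht
  exact F.injective hst ▸ hs

theorem IsInvariantClosed.pow_mem {M : Set ℝ} (hM : IsInvariantClosed F M) {t : ℝ} (ht : t ∈ M)
    (n : ℕ) : (F ^ n) t ∈ M := by
  induction n with
  | zero => exact ht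
  | succ n ih => rw [pow_succ_apply]; exact hM.map_mem _ ih

/-- Points of a minimal set are recurrent. -/
theorem IsInvariantClosed.recurrent {M : Set ℝ} (hF : F ∈ PeriodicDiffeo)
    (hM : Minimal (· ∈ {B | IsInvariantClosed F B}) M) {a : ℝ} (ha : a ∈ M) (N : ℕ) {ε : ℝ}
    (hε : 0 < ε) : ∃ n ≥ N, ∃ m : ℤ, |(F ^ n) a + m * (2 * Real.pi) - a| < ε := by
  have hMi : IsInvariantClosed F M := hM.1
  set O : Set ℝ := {t | ∃ n ≥ N, ∃ m : ℤ, (F ^ n) a + m * (2 * Real.pi) = t} with hO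
  have hOM : O ⊆ M := by
    rintro _ ⟨n, -, m, rfl⟩
    exact hMi.add_mem _ (hMi.pow_mem ha n) m
  have hcl : IsInvariantClosed F (closure O) := by
    refine ⟨isClosed_closure, ⟨_, subset_closure ⟨N, le_rfl, 0, rfl⟩⟩, ?_, ?_⟩
    · intro t ht m
      refine map_mem_closure (f := fun t => t + m * (2 * Real.pi))
        (continuous_id.add continuous_const) ht ?_
      rintro _ ⟨n, hn, k, rfl⟩
      refine ⟨n, hn, k + m, ?_⟩
      push_cast
      ring
    · intro t ht
      refine map_mem_closure F.continuous ht ?_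
      rintro _ ⟨n, hn, k, rfl⟩
      refine ⟨n + 1, by omega, k, ?_⟩
      rw [pow_succ_apply, apply_add_int hF.1]
  have haO := hM.2 hcl (closure_minimal hOM hMi.isClosed) ha
  obtain ⟨_, ⟨n, hn, m, rfl⟩, hd⟩ := Metric.mem_closure_iff.1 haO ε hε
  refine ⟨n, hn, m, ?_⟩
  rwa [dist_comm, Real.dist_eq] at hd

/-- **Denjoy's theorem**: a `C²` circle diffeomorphism without periodic points is minimal. -/
theorem denjoy (hF : F ∈ PeriodicDiffeo) (hap : Aperiodic F) {A : Set ℝ}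
    (hA : IsInvariantClosed F A) : A = univ := by
  obtain ⟨M, hMA, hM⟩ := hA.exists_minimal
  have hMi : IsInvariantClosed F M := hM.1
  by_contra hne
  obtain ⟨t, ht⟩ : ∃ t, t ∉ M := by
    by_contra! h
    exact hne (eq_univ_of_univ_subset fun x _ => hMA (h x))
  obtain ⟨a, b, hat, htb, ha, hb, hab⟩ := exists_gap hMi.isClosed hMi.nonempty hMi.add_mem ht
  have hlt : a < b := hat.trans htb
  have hFn : ∀ n : ℕ, F ^ n ∈ PeriodicDiffeo := fun n => Subgroup.pow_mem _ hF n
  have hgap : ∀ n : ℕ, ∀ x ∈ Ioo ((F ^ n) a) ((F ^ n) b), x ∉ M := by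
    intro n
    induction n with
    | zero => exact hab
    | succ n ih =>
      intro x hx hxM
      rw [pow_succ_apply, pow_succ_apply] at hx
      obtain ⟨y, rfl⟩ := F.surjective x
      exact ih y ⟨F.lt_iff_lt.1 hx.1, F.lt_iff_lt.1 hx.2⟩
        (IsInvariantClosed.mem_of_map_mem hF hM hxM)
  have hb2 : b ≤ a + 2 * Real.pi := by
    by_contra! h
    refine hab (a + 2 * Real.pi) ⟨by linarith [Real.two_pi_pos], h⟩ ?_
    simpa using hMi.add_mem a ha 1
  -- The gap is wandering: two overlapping images would share their left end, which would make `a`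
  -- periodic modulo `2π`.
  have hsum : ∀ n : ℕ, ∑ j ∈ Finset.range n, ((F ^ j) b - (F ^ j) a) ≤ 4 * Real.pi := by
    refine sum_length_le (fun j => (F ^ j).monotone hlt.le) (fun j => ?_) ?_
    · rw [← (hFn j).1]
      exact (F ^ j).monotone hb2
    · intro i j hij m
      refine Set.disjoint_left.2 fun x hxi hxj => ?_
      have h1 : (F ^ i) a + m * (2 * Real.pi) ≤ (F ^ j) a := by
        by_contra! h
        exact hgap j _ ⟨h, hxi.1.trans hxj.2⟩ (hMi.add_mem _ (hMi.pow_mem ha i) m)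
      have h2 : (F ^ j) a ≤ (F ^ i) a + m * (2 * Real.pi) := by
        by_contra! h
        refine hgap i ((F ^ j) a + (-m : ℤ) * (2 * Real.pi)) ⟨?_, ?_⟩
          (hMi.add_mem _ (hMi.pow_mem ha j) (-m))
        · push_cast; linarith
        · have := hxj.1.trans hxi.2
          push_cast
          linarith
      have heq : (F ^ i) (a + m * (2 * Real.pi)) = (F ^ j) a := by
        rw [apply_add_int (hFn i).1]
        exact le_antisymm h1 h2
      rcases lt_or_gt_of_ne hij with h | h
      · rw [show j = i + (j - i) by omega, pow_add, RelIso.mul_apply] at heq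
        exact hap (j - i) (by omega) m a ((F ^ i).injective heq).symm
      · rw [show i = j + (i - j) by omega, pow_add, RelIso.mul_apply] at heq
        have h3 := (F ^ j).injective heq
        rw [apply_add_int (hFn (i - j)).1] at h3
        refine hap (i - j) (by omega) (-m) a ?_
        push_cast
        linarith
  obtain ⟨K, hK0, hK⟩ := exists_log_deriv_lipschitz hF
  set E := Real.exp (K * (8 * Real.pi)) with hE
  have hE0 : 0 < E := Real.exp_pos _
  set δ := (b - a) / E with hδ
  have hδ0 : 0 < δ := div_pos (sub_pos.2 hlt) hE0
  -- Denjoy's induction: while the images of `[a - δ, a]` are no longer than those of the gap,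
  -- points of the two intervals stay within twice the gap's length, so the distortion is at most
  -- `E` (whence `8π = 2 · 4π`). The choice `δ = (b - a) / E` absorbs it at the next step.
  have hcontr : ∀ n : ℕ, (F ^ n) a - (F ^ n) (a - δ) ≤ (F ^ n) b - (F ^ n) a := by
    intro n
    induction n using Nat.strong_induction_on with
    | _ n ih =>
      obtain ⟨x, hx, hx'⟩ := exists_deriv_eq_slope (F ^ n : ℝ ≃o ℝ) (sub_lt_self a hδ0)
        (F ^ n).continuous.continuousOn (differentiable (hFn n)).differentiableOn
      obtain ⟨y, hy, hy'⟩ := exists_deriv_eq_slope (F ^ n : ℝ ≃o ℝ) hlt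
        (F ^ n).continuous.continuousOn (differentiable (hFn n)).differentiableOn
      have h1 : ∑ j ∈ Finset.range n, |(F ^ j) x - (F ^ j) y| ≤ 8 * Real.pi := by
        calc _ ≤ ∑ j ∈ Finset.range n, 2 * ((F ^ j) b - (F ^ j) a) := by
              refine Finset.sum_le_sum fun j hj => ?_
              have h2 := ih j (Finset.mem_range.1 hj)
              have h3 := (F ^ j).monotone hx.1.le
              have h4 := (F ^ j).monotone hx.2.le
              have h5 := (F ^ j).monotone hy.1.le
              have h6 := (F ^ j).monotone hy.2.le
              rw [abs_le]
              constructor <;> linarith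
          _ ≤ 8 * Real.pi := by
              rw [← Finset.mul_sum]
              linarith [hsum n]
      have h2 := deriv_pow_le hF hK n x y
      have h3 : deriv (F ^ n : ℝ ≃o ℝ) x ≤ E * deriv (F ^ n : ℝ ≃o ℝ) y :=
        h2.trans (mul_le_mul_of_nonneg_right
          (Real.exp_le_exp.2 (mul_le_mul_of_nonneg_left h1 hK0)) (deriv_pos (hFn n) y).le)
      rw [hx', hy', sub_sub_cancel, div_le_iff₀ hδ0] at h3
      refine h3.trans_eq ?_
      rw [hδ]
      have := (sub_pos.2 hlt).ne'
      field_simp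
  have hlim : Tendsto (fun n : ℕ => (F ^ n) b - (F ^ n) a) atTop (𝓝 0) :=
    (summable_of_sum_range_le (fun n => sub_nonneg.2 ((F ^ n).monotone hlt.le))
      hsum).tendsto_atTop_zero
  obtain ⟨N, hN⟩ := eventually_atTop.1 (hlim.eventually_lt_const (half_pos hδ0))
  -- The bound `max N 1` excludes `n = 0`. A return closer than `b - a` cannot fall inside the gap,
  -- so it is at or to the left of `a`; then `F ^ n`, suitably translated, maps the shrunken `[a -
  -- δ, a]` into itself and has a fixed point.
  obtain ⟨n, hn, m, hm⟩ := IsInvariantClosed.recurrent hF hM ha (max N 1)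
    (lt_min (half_pos hδ0) (sub_pos.2 hlt))
  rw [lt_min_iff, abs_lt, abs_lt] at hm
  have hle : (F ^ n) a + m * (2 * Real.pi) ≤ a := by
    by_contra! h
    exact hab _ ⟨h, by linarith [hm.2.2]⟩ (hMi.add_mem _ (hMi.pow_mem ha n) m)
  have hge : a - δ ≤ (F ^ n) (a - δ) + m * (2 * Real.pi) := by
    have h1 := hN n (le_of_max_le_left hn)
    have h2 := hcontr n
    linarith [hm.1.1]
  have hc : IsPreconnected (univ : Set ℝ) := isPreconnected_univ
  obtain ⟨z, -, hz⟩ := hc.intermediate_value₂ (mem_univ a) (mem_univ (a - δ))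
    (f := fun t => (F ^ n) t + m * (2 * Real.pi)) (g := id)
    ((F ^ n).continuous.add continuous_const).continuousOn continuousOn_id hle hge
  refine hap n (by have := le_of_max_le_right hn; omega) (-m) z ?_
  simp only [id] at hz
  push_cast
  linarith

/-- The centralizer of a diffeomorphism without periodic points is commutative. -/
theorem commute_of_aperiodic (hF : F ∈ PeriodicDiffeo) (hap : Aperiodic F) {A B : ℝ ≃o ℝ}
    (hA : A ∈ PeriodicDiffeo) (hB : B ∈ PeriodicDiffeo) (hFA : Commute F A) (hFB : Commute F B)
    (t : ℝ) : A (B t) = B (A t) := by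
  refine OrderIso.hoelder_commute (Γ := PeriodicDiffeo ⊓ Subgroup.centralizer {F}) (S := univ)
    ordConnected_univ (fun _ _ _ _ => mem_univ _) ?_
    ⟨hA, Subgroup.mem_centralizer_singleton_iff.2 hFA.symm⟩
    ⟨hB, Subgroup.mem_centralizer_singleton_iff.2 hFB.symm⟩ (mem_univ t)
  rintro γ ⟨hγ, hγF⟩ x - hx y -
  have hcomm : Commute γ F := Subgroup.mem_centralizer_singleton_iff.1 hγF
  have hfix : IsInvariantClosed F {t | γ t = t} := by
    refine ⟨γ.isClosed_fixedPoints, ⟨x, hx⟩, fixed_periodic hγ, fun s hs => ?_⟩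
    change γ (F s) = F s
    rw [commute_apply hcomm, show γ s = s from hs]
  have := denjoy hF hap hfix
  exact this.ge (mem_univ y)

end PeriodicDiffeo

/-! ### Lifts of circle diffeomorphisms. -/

namespace PeriodicDiffeo

variable {r : WithTop ℕ∞} {F G : ℝ ≃o ℝ} {f g : DiffPlus r}

/-- `F` is a lift of `f` through the universal covering `t ↦ exp (i t)`. -/
def Lifts (F : ℝ ≃o ℝ) (f : DiffPlus r) : Prop :=
  ∀ t : ℝ, Circle.exp (F t) = (f : CircleDiffeo r) (Circle.exp t)

theorem Lifts.mul (hF : Lifts F f) (hG : Lifts G g) : Lifts (F * G) (f * g) := fun t => by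
  rw [RelIso.mul_apply, hF, hG]
  rfl

theorem Lifts.inv (hF : Lifts F f) : Lifts F⁻¹ f⁻¹ := fun t => by
  have h := hF (F⁻¹ t)
  rw [RelIso.apply_inv_self] at h
  rw [h, Subgroup.coe_inv, CircleDiffeo.inv_apply_apply]

theorem Lifts.pow (hF : Lifts F f) (n : ℕ) : Lifts (F ^ n) (f ^ n) := by
  induction n with
  | zero => exact fun t => by rw [pow_zero, pow_zero]; rfl
  | succ n ih => rw [pow_succ, pow_succ]; exact ih.mul hF

theorem Lifts.shift_mul (hF : Lifts F f) (m : ℤ) : Lifts (shift m * F) f := fun t => by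
  rw [← hF, RelIso.mul_apply, shift_apply]
  exact Circle.exp_eq_exp.2 ⟨m, rfl⟩

theorem Lifts.eq (hF : Lifts F f) (hG : Lifts F g) : f = g := by
  refine Subtype.ext (Diffeomorph.ext fun x => ?_)
  obtain ⟨t, rfl⟩ := Circle.exp_surjective x
  rw [← hF, ← hG]

theorem Lifts.apply_add_two_pi (hF : Lifts F f) (t : ℝ) :
    F (t + 2 * Real.pi) = F t + 2 * Real.pi := by
  obtain ⟨m, hm⟩ := Circle.exp_eq_exp.1 (show Circle.exp (F (t + 2 * Real.pi)) = Circle.exp (F t) by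
    rw [hF, hF, Circle.exp_add_two_pi])
  have hpi := Real.two_pi_pos
  have h1 : F t < F (t + 2 * Real.pi) := F.strictMono (by linarith)
  have hm0 : 0 < m := by
    have : (0 : ℝ) < m := pos_of_mul_pos_left (by linarith) hpi.le
    exact_mod_cast this
  rcases (show 1 ≤ m from hm0).eq_or_lt with h | h
  · rw [hm, ← h, Int.cast_one, one_mul]
  -- If `F` advanced by more than one turn, some `s` strictly inside the period would have `F s = F
  -- t + 2π`, against injectivity on the circle.
  · exfalso
    obtain ⟨s, hs⟩ := F.surjective (F t + 2 * Real.pi)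
    have hs1 : t < s := F.lt_iff_lt.1 (by linarith)
    have hs2 : s < t + 2 * Real.pi := by
      refine F.lt_iff_lt.1 ?_
      have : (1 : ℝ) < m := by exact_mod_cast h
      rw [hs, hm]
      nlinarith
    have h2 : Circle.exp s = Circle.exp t := by
      refine (f : CircleDiffeo r).injective ?_
      change (f : CircleDiffeo r) (Circle.exp s) = (f : CircleDiffeo r) (Circle.exp t)
      rw [← hF, ← hF, hs, Circle.exp_add_two_pi]
    obtain ⟨k, hk⟩ := Circle.exp_eq_exp.1 h2
    have hk0 : (0 : ℝ) < k := pos_of_mul_pos_left (by linarith) hpi.le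
    have hk1 : (k : ℝ) < 1 := by
      by_contra! h'
      nlinarith
    have h3 : 0 < k := by exact_mod_cast hk0
    have h4 : k < 1 := by exact_mod_cast hk1
    omega

attribute [local instance] finrank_real_complex_fact'

theorem contMDiff_circle_coe {m : ℕ∞ω} :
    ContMDiff (𝓡 1) 𝓘(ℝ, ℂ) m (fun z : Circle => (z : ℂ)) :=
  contMDiff_coe_sphere (E := ℂ) (n := 1)

theorem Lifts.contDiff (hr : 2 ≤ r) (hF : Lifts F f) : ContDiff ℝ 2 F := by
  have hφ : ContDiff ℝ 2 fun t : ℝ => ((f : CircleDiffeo r) (Circle.exp t) : ℂ) := by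
    rw [← contMDiff_iff_contDiff]
    exact contMDiff_circle_coe.comp
      (((f : CircleDiffeo r).contMDiff.of_le hr).comp contMDiff_circleExp)
  have hφ' : (fun t : ℝ => ((f : CircleDiffeo r) (Circle.exp t) : ℂ)) =
      fun t => Complex.exp (F t * Complex.I) := by
    ext t
    rw [← hF, Circle.coe_exp]
  rw [hφ'] at hφ
  rw [contDiff_iff_contDiffAt]
  intro s
  have h1 : ContDiffAt ℝ 2 (fun t => Complex.exp (F t * Complex.I) *
      Complex.exp (-(F s * Complex.I))) s := (hφ.mul contDiff_const).contDiffAt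
  have h2 : ContDiffAt ℝ 2 (fun t => Complex.log (Complex.exp (F t * Complex.I) *
      Complex.exp (-(F s * Complex.I)))) s := by
    refine ContDiffAt.comp s (g := Complex.log) ?_ h1
    refine ContDiffAt.restrict_scalars ℝ (Complex.contDiffAt_log ?_)
    rw [← Complex.exp_add, add_neg_cancel, Complex.exp_zero]
    exact Complex.one_mem_slitPlane
  -- Near `s` the lift is recovered through the principal logarithm, after rotating `exp (i F s)` to
  -- `1`, away from the branch cut.
  have h3 : ContDiffAt ℝ 2 (fun t => (Complex.log (Complex.exp (F t * Complex.I) *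
      Complex.exp (-(F s * Complex.I)))).im + F s) s :=
    (Complex.imCLM.contDiff.contDiffAt.comp s h2).add contDiffAt_const
  refine h3.congr_of_eventuallyEq ?_
  have h4 : ∀ᶠ t in 𝓝 s, |F t - F s| < Real.pi := by
    have := (F.continuous.tendsto s).eventually (Metric.ball_mem_nhds (F s) Real.pi_pos)
    exact this
  filter_upwards [h4] with t ht
  rw [abs_lt] at ht
  have h5 : (F t * Complex.I + -(F s * Complex.I) : ℂ) = ((F t - F s : ℝ) : ℂ) * Complex.I := by
    push_cast
    ring
  rw [← Complex.exp_add, h5, Complex.log_exp (by simpa using ht.1) (by simpa using ht.2.le)]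
  simp

theorem Lifts.mem (hr : 2 ≤ r) (hF : Lifts F f) : F ∈ PeriodicDiffeo :=
  ⟨hF.apply_add_two_pi, hF.contDiff hr, hF.inv.contDiff hr⟩

theorem exists_lifts (f : DiffPlus r) : ∃ F : ℝ ≃o ℝ, Lifts F f := f.2

theorem exists_int_of_commute (hF : Lifts F f) (hG : Lifts G g) (hfg : Commute f g) :
    ∃ m : ℤ, ∀ t, F (G t) = G (F t) + m * (2 * Real.pi) := by
  have hpi := Real.two_pi_pos
  have h1 : ∀ t, ∃ m : ℤ, F (G t) = G (F t) + m * (2 * Real.pi) := fun t => by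
    refine Circle.exp_eq_exp.1 ?_
    rw [← RelIso.mul_apply, ← RelIso.mul_apply, hF.mul hG, hG.mul hF, hfg.eq]
  choose m hm using h1
  have hc : Continuous fun t => F (G t) - G (F t) :=
    (F.continuous.comp G.continuous).sub (G.continuous.comp F.continuous)
  have hd : ∀ t, F (G t) - G (F t) = m t * (2 * Real.pi) := fun t => by rw [hm]; ring
  have hle : ∀ s t, m t ≤ m s := by
    intro s t
    by_contra! h
    have h' : (m s : ℝ) + 1 ≤ m t := by exact_mod_cast h
    obtain ⟨z, hz⟩ := mem_range_of_exists_le_of_exists_ge hc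
      (c := (m s + 1 / 2) * (2 * Real.pi)) ⟨s, by rw [hd]; nlinarith⟩ ⟨t, by rw [hd]; nlinarith⟩
    have h2 : F (G z) - G (F z) = (m s + 1 / 2) * (2 * Real.pi) := hz
    rw [hd] at h2
    replace h2 := mul_right_cancel₀ hpi.ne' h2
    have h3 : ((2 * m z : ℤ) : ℝ) = ((2 * m s + 1 : ℤ) : ℝ) := by push_cast; linarith
    have h4 : 2 * m z = 2 * m s + 1 := by exact_mod_cast h3
    omega
  exact ⟨m 0, fun t => by rw [hm t, le_antisymm (hle 0 t) (hle t 0)]⟩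

/-- Lifts of commuting circle diffeomorphisms commute. -/
theorem Lifts.commute (hF : Lifts F f) (hG : Lifts G g) (hfg : Commute f g) : Commute F G := by
  have hpi := Real.two_pi_pos
  obtain ⟨m, hm⟩ := exists_int_of_commute hF hG hfg
  -- The commutation defect grows linearly in `n`, whereas the bounded displacement of `F` keeps it
  -- bounded; hence `m = 0`.
  have hpow : ∀ (n : ℕ) t, F ((G ^ n) t) = (G ^ n) (F t) + (n * m : ℤ) * (2 * Real.pi) := by
    intro n t
    induction n with
    | zero => simp
    | succ n ih =>
      rw [pow_succ_apply, hm, ih, apply_add_int hG.apply_add_two_pi, pow_succ_apply]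
      push_cast
      ring
  have hbd : ∃ N : ℕ, ∀ t, t - N * (2 * Real.pi) ≤ F t ∧ F t ≤ t + N * (2 * Real.pi) := by
    obtain ⟨N, hN⟩ := exists_nat_gt (|F 0| / (2 * Real.pi))
    rw [div_lt_iff₀ hpi] at hN
    refine ⟨N + 1, fun t => ?_⟩
    obtain ⟨k, hk, -⟩ := existsUnique_add_zsmul_mem_Ico hpi t 0
    simp only [zsmul_eq_mul, zero_add] at hk
    have h1 := F.monotone hk.1
    have h2 := F.monotone hk.2.le
    have h3 := hF.apply_add_two_pi 0
    rw [zero_add] at h3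
    rw [h3] at h2
    rw [apply_add_int hF.apply_add_two_pi] at h1 h2
    have h4 := abs_lt.1 hN
    push_cast
    constructor <;> linarith [hk.1, hk.2, h4.1, h4.2]
  obtain ⟨N, hN⟩ := hbd
  have hm0 : m = 0 := by
    by_contra hne
    have hN' : ∀ n : ℕ, |(n * m : ℤ)| ≤ (2 * N : ℕ) := by
      intro n
      have hGn : Lifts (G ^ n) (g ^ n) := hG.pow n
      have h1 := hpow n 0
      have h2 := hN ((G ^ n) 0)
      have h3 := (G ^ n).monotone (hN 0).1
      have h4 := (G ^ n).monotone (hN 0).2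
      have h5 := apply_add_int hGn.apply_add_two_pi 0 (-N)
      have h6 := apply_add_int hGn.apply_add_two_pi 0 N
      push_cast at h1 h5 h6
      rw [show (0 : ℝ) - N * (2 * Real.pi) = 0 + -N * (2 * Real.pi) by ring, h5] at h3
      rw [h6] at h4
      have h7 : ((n : ℝ) * m) * (2 * Real.pi) ≤ (2 * N) * (2 * Real.pi) := by linarith [h2.2]
      have h8 : (-(2 * N : ℝ)) * (2 * Real.pi) ≤ ((n : ℝ) * m) * (2 * Real.pi) := by
        linarith [h2.1]
      have h9 := le_of_mul_le_mul_right h7 hpi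
      have h10 := le_of_mul_le_mul_right h8 hpi
      rw [abs_le]
      constructor
      · exact_mod_cast h10
      · exact_mod_cast h9
    have h1 := hN' (2 * N + 1)
    rw [abs_mul] at h1
    have h2 : 1 ≤ |m| := Int.one_le_abs hne
    rw [abs_of_nonneg (by positivity)] at h1
    push_cast at h1
    nlinarith
  ext t
  rw [RelIso.mul_apply, RelIso.mul_apply, hm, hm0, Int.cast_zero, zero_mul, add_zero]

/-- Either a lift of `f` has no periodic points, or a power of `f` has a lift with fixed points. -/
theorem aperiodic_or_fixed (f : DiffPlus r) :
    (∃ F, Lifts F f ∧ Aperiodic F) ∨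
      ∃ n : ℕ, n ≠ 0 ∧ ∃ F : ℝ ≃o ℝ, Lifts F (f ^ n) ∧ ∃ t, F t = t := by
  obtain ⟨F, hF⟩ := exists_lifts f
  by_cases hap : Aperiodic F
  · exact Or.inl ⟨F, hF, hap⟩
  · unfold Aperiodic at hap
    push Not at hap
    obtain ⟨n, hn, m, t, h⟩ := hap
    refine Or.inr ⟨n, hn, shift (-m) * F ^ n, (hF.pow n).shift_mul _, t, ?_⟩
    rw [RelIso.mul_apply, shift_apply, h]
    push_cast
    ring

theorem Lifts.commute_of_aperiodic {g₁ g₂ : DiffPlus r} (hr : 2 ≤ r) (hF : Lifts F f)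
    (hap : Aperiodic F) (h₁ : Commute f g₁) (h₂ : Commute f g₂) : Commute g₁ g₂ := by
  obtain ⟨A, hA⟩ := exists_lifts g₁
  obtain ⟨B, hB⟩ := exists_lifts g₂
  have h := PeriodicDiffeo.commute_of_aperiodic (hF.mem hr) hap (hA.mem hr) (hB.mem hr)
    (hF.commute hA h₁) (hF.commute hB h₂)
  have hAB : A * B = B * A := by
    ext t
    exact h t
  exact (hA.mul hB).eq (hAB ▸ hB.mul hA)

end PeriodicDiffeo

/-! ### The dichotomy. -/

open PeriodicDiffeo

theorem proposition2p12 (r : WithTop ℕ∞) (hr : 2 ≤ r) (G H : Subgroup (DiffPlus r))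
    (hG : ∃ g₁ ∈ G, ∃ g₂ ∈ G, ¬ Commute g₁ g₂)
    (hH : H ≤ Subgroup.centralizer (G : Set (DiffPlus r))) :
    (∀ h₁ ∈ H, ∀ h₂ ∈ H, ∃ k₁ k₂ : ℤ, k₁ ≠ 0 ∧ k₂ ≠ 0 ∧ Commute (h₁ ^ k₁) (h₂ ^ k₂)) ∨
    (∃ J : Set Circle, IsCircleInterval J ∧
      ∀ g ∈ G, ∃ k : ℤ, k ≠ 0 ∧ ∀ x ∈ J, ((g ^ k : DiffPlus r) : CircleDiffeo r) x = x) := by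
  have hcomm : ∀ g ∈ G, ∀ h ∈ H, Commute g h := fun g hg h hh =>
    Subgroup.mem_centralizer_iff.1 (hH hh) g hg
  by_cases hGap : ∃ g ∈ G, ∃ F, Lifts F g ∧ Aperiodic F
  · obtain ⟨g, hg, F, hF, hap⟩ := hGap
    refine Or.inl fun h₁ hh₁ h₂ hh₂ => ⟨1, 1, one_ne_zero, one_ne_zero, ?_⟩
    rw [zpow_one, zpow_one]
    exact hF.commute_of_aperiodic hr hap (hcomm g hg h₁ hh₁) (hcomm g hg h₂ hh₂)
  have hHfix : ∀ h ∈ H, ∃ n : ℕ, n ≠ 0 ∧ ∃ F : ℝ ≃o ℝ, Lifts F (h ^ n) ∧ ∃ t, F t = t := by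
    intro h hh
    refine (aperiodic_or_fixed h).resolve_left ?_
    rintro ⟨F, hF, hap⟩
    obtain ⟨g₁, hg₁, g₂, hg₂, hne⟩ := hG
    exact hne (hF.commute_of_aperiodic hr hap (hcomm g₁ hg₁ h hh).symm (hcomm g₂ hg₂ h hh).symm)
  by_cases hJ : ∃ J : Set Circle, IsCircleInterval J ∧
      ∀ g ∈ G, ∃ k : ℤ, k ≠ 0 ∧ ∀ x ∈ J, ((g ^ k : DiffPlus r) : CircleDiffeo r) x = x
  · exact Or.inr hJ
  refine Or.inl fun h₁ hh₁ h₂ hh₂ => ?_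
  obtain ⟨n₁, hn₁, A, hA, hA0⟩ := hHfix h₁ hh₁
  obtain ⟨n₂, hn₂, B, hB, hB0⟩ := hHfix h₂ hh₂
  refine ⟨n₁, n₂, by exact_mod_cast hn₁, by exact_mod_cast hn₂, ?_⟩
  rw [zpow_natCast, zpow_natCast]
  have hclosed : IsClosed {t | A (B t) = B (A t)} :=
    isClosed_eq (A.continuous.comp B.continuous) (B.continuous.comp A.continuous)
  -- An interval free of commutation points would contain some `[c, d]`, chosen independently of `g`
  -- and shorter than `2π`, on which a power of each `g ∈ G` is the identity.
  have hdense : Dense {t | A (B t) = B (A t)} := by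
    refine dense_of_exists_between fun {a b} hab => ?_
    obtain ⟨c, hac, hcb⟩ := exists_between hab
    obtain ⟨d, hcd, hd⟩ := exists_between (lt_min hcb
      (show c < c + 2 * Real.pi by linarith [Real.two_pi_pos]))
    by_contra! hnot
    refine hJ ⟨Circle.exp '' Icc c d, ⟨c, d, hcd, hd.trans_le (min_le_right _ _), rfl⟩,
      fun g hg => ?_⟩
    obtain ⟨n, hn, K, hK, hK0⟩ := (aperiodic_or_fixed g).resolve_left
      fun ⟨F, hF, hap⟩ => hGap ⟨g, hg, F, hF, hap⟩
    refine ⟨n, by exact_mod_cast hn, ?_⟩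
    rintro _ ⟨t, ht, rfl⟩
    rw [zpow_natCast, ← hK]
    congr 1
    by_contra hKt
    refine hnot t ?_ ⟨hac.trans_le ht.1, ht.2.trans_lt (hd.trans_le (min_le_left _ _))⟩
    exact commute_apply_of_ne (hA.mem hr) (hB.mem hr) (hK.mem hr)
      (hA.commute hK ((hcomm g hg h₁ hh₁).symm.pow_pow _ _))
      (hB.commute hK ((hcomm g hg h₂ hh₂).symm.pow_pow _ _)) hA0 hB0 hK0 hKt
  have huniv : {t | A (B t) = B (A t)} = univ := by
    rw [← hclosed.closure_eq, hdense.closure_eq]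
  have hAB : A * B = B * A := by
    ext t
    exact huniv.ge (mem_univ t)
  exact (hA.mul hB).eq (hAB ▸ hB.mul hA)
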